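/- Let $n\ge 1$, let $(E,\mathcal B)$ be a measurable space and let $\mathcal T$ be a nonempty set of functions from $E$ to $[-1,1]$. Let $\xi=(\xi_1,\dots,\xi_n)$ be an exchangeable real random vector (for every permutation $\sigma$ of $\{1,\dots,n\}$, $(\xi_{\sigma(1)},\dots,\xi_{\sigma(n)})$ has the same law as $\xi$) such that $\kappa:=\mathbb E|\xi_1|<\infty$ and $\sum_{i=1}^n\xi_i=0$ almost surely. For $x=(x_1,\dots,x_n)\in E^n$ put \[ \overline g(x)=\mathbb E\Bigl[\sup_{t\in\mathcal T}\sum_{i=1}^n \xi_i\,t(x_i)\Bigr]. \] Call a function $f:E^n\to\mathbb R$ $(a,b)$-self-bounding if for every $i\in\{1,\dots,n\}$ there is a function $f_i:E^{n-1}\to\mathbb R$ such that for all $x\in E^n$, writing $x_{(i)}=(x_1,\dots,x_{i-1},x_{i+1},\dots,x_n)$, \[ 0\le f(x)-f_i(x_{(i)})\le 1\quad (1\le i\le n)\qquad\text{and}\qquad \sum_{i=1}^n\bigl(f(x)-f_i(x_{(i)})\bigr)\le a f(x)+b. \] Then: (i) For every $x\in E^n$ the random variable $\sup_{t\in\mathcal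 T}\sum_{i}\xi_i t(x_i)$ is integrable, so that $\overline g(x)$ is well defined; and if $\kappa>0$, the function $\overline g/\bigl(\kappa(3-\tfrac2n)\bigr)$ is $(2,0)$-self-bounding. (ii) Let $X=(X_1,\dots,X_n)$ be a vector of independent $E$-valued random variables (not necessarily identically distributed) such that $\overline g$ is measurable on $E^n$ with respect to the completion of the product $\sigma$-algebra $\mathcal B^{\otimes n}$ under the law of $X$. Then $\overline g(X)$ is integrable and, for every $x>0$, \[ \overline g(X)\le \mathbb E[\overline g(X)]+\sqrt{12\,\kappa\,x\,\mathbb E[\overline g(X)]}+5\kappa x \] with probability at least $1-e^{-x}$, and \[ \overline g(X)\ge \mathbb E[\overline g(X)]-\sqrt{12\,\kappa\,x\,\mathbb E[\overline g(X)]} \] with probability at least $1-e^{-x}$. -/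

import Mathlib

open MeasureTheory ProbabilityTheory

/-- A real random vector `(ξ i)` is exchangeable under `μ`: permuting its coordinates does not change
its law (`IdentDistrib` includes the a.e.-measurability of both vectors). -/
def IsExchangeable {Ω : Type*} [MeasurableSpace Ω] {n : ℕ} (ξ : Fin n → Ω → ℝ) (μ : Measure Ω) :
    Prop :=
  ∀ σ : Equiv.Perm (Fin n), IdentDistrib (fun ω i => ξ (σ i) ω) (fun ω i => ξ i ω) μ μ

/-- `f : E ^ n → ℝ` is `(a, b)`-self-bounding. The functions `F i` depend only on the vector
obtained from `x` by deleting its `i`-th coordinate. -/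
def IsSelfBounding {E : Type*} {n : ℕ} (a b : ℝ) (f : (Fin n → E) → ℝ) : Prop :=
  ∃ F : (i : Fin n) → ({j : Fin n // j ≠ i} → E) → ℝ, ∀ x : Fin n → E,
    (∀ i, 0 ≤ f x - F i (fun j => x j) ∧ f x - F i (fun j => x j) ≤ 1) ∧
      ∑ i, (f x - F i (fun j => x j)) ≤ a * f x + b

/-- The supremum `g(x, w) = sup_{t ∈ T} ∑ i, w i * t (x i)` of the weighted empirical process. -/
noncomputable def weightedSup {E : Type*} {n : ℕ} (T : Set (E → ℝ)) (x : Fin n → E)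
    (w : Fin n → ℝ) : ℝ :=
  ⨆ t : T, ∑ i, w i * (t : E → ℝ) (x i)

/-- The function `x ↦ E[sup_{t ∈ T} ∑ i, ξ i * t (x i)]` on `E ^ n`. -/
noncomputable def gbar {E Ω : Type*} [MeasurableSpace Ω] {n : ℕ} (T : Set (E → ℝ))
    (ξ : Fin n → Ω → ℝ) (μ : Measure Ω) (x : Fin n → E) : ℝ :=
  ∫ ω, weightedSup T x (fun i => ξ i ω) ∂μ

/-!
The averaged supremum `gbar` is self-bounding up to a scalar, and self-bounding functions of
independent variables concentrate.

*Self-bounding property.* Exchanging the `i`-th weight with a uniformly chosen one, and averaging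
over the choice, gives the weights `leaveOut w i`; as the weights sum to zero, the `i`-th of them
becomes zero, so that the corresponding expectation is a function of the points other than the
`i`-th. By exchangeability and convexity of the supremum this expectation is at most `gbar`
(`integral_leaveOut_le_gbar`). It differs from `gbar` by at most `κ (3 - 2 / n)` because the
supremum is Lipschitz in the weights. Finally `∑ i, leaveOut w i = (n - 2) w`, so subadditivity of
the supremum bounds the sum of the differences by `2 gbar`.

*Concentration.* This is the entropy method. The entropy of `exp (l f)` is tensorized in
`entropy_exp_le_sum`, where the entropy in each coordinate is already replaced by its variational
upper bound with a free competitor, a function not depending on that coordinate. The competitor is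
the exponential of `l` times the essential infimum of `f` along the coordinate (`coordEssInf`),
which is measurable and dominates whatever function witnesses the self-bounding property. This
gives a differential inequality for the cumulant generating function `ψ` of `f`
(`IsSelfBounding.exists_cgf_deriv`):
`l ψ' - ψ ≤ (exp (-l) + l - 1) (a ψ' + b)`.
With `m` the mean of `f` and `v = a m + b`, comparison with `l m + v l² / (2 (1 - a l / 2))` on the
right of the origin and with `l m + v l² / 2` on the left yields, by Chernoff's bound, deviations
`√(2 v x) + a x / 2` above and `√(2 v x)` below. For `f = gbar / K` with `K = κ (3 - 2 / n) ≤ 3 κ`,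
`a = 2` and `b = 0`, multiplication by `K` gives the announced inequalities.
-/

/-! ### Bounded measurable functions -/

/-- A bounded measurable real function. Against a probability measure all the integrals below are
integrals of such functions, so that no integrability question arises. -/
def BoundedMeasurable {α : Type*} [MeasurableSpace α] (f : α → ℝ) : Prop :=
  Measurable f ∧ ∃ C, ∀ x, |f x| ≤ C

namespace BoundedMeasurable

variable {α β : Type*} [MeasurableSpace α] [MeasurableSpace β] {f g : α → ℝ}

lemma integrable (hf : BoundedMeasurable f) (μ : Measure α) [IsFiniteMeasure μ] :
    Integrable f μ := by
  obtain ⟨hm, C, hC⟩ := hf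
  exact Integrable.of_bound hm.aestronglyMeasurable C (Filter.Eventually.of_forall hC)

lemma const (c : ℝ) : BoundedMeasurable (fun _ : α => c) :=
  ⟨measurable_const, |c|, fun _ => le_rfl⟩

lemma add (hf : BoundedMeasurable f) (hg : BoundedMeasurable g) :
    BoundedMeasurable (fun x => f x + g x) := by
  obtain ⟨hm, C, hC⟩ := hf
  obtain ⟨hm', C', hC'⟩ := hg
  exact ⟨hm.add hm', C + C', fun x => (abs_add_le _ _).trans (add_le_add (hC x) (hC' x))⟩

lemma mul (hf : BoundedMeasurable f) (hg : BoundedMeasurable g) :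
    BoundedMeasurable (fun x => f x * g x) := by
  obtain ⟨hm, C, hC⟩ := hf
  obtain ⟨hm', C', hC'⟩ := hg
  refine ⟨hm.mul hm', C * C', fun x => ?_⟩
  rw [abs_mul]
  exact mul_le_mul (hC x) (hC' x) (abs_nonneg _) ((abs_nonneg _).trans (hC x))

lemma sub (hf : BoundedMeasurable f) (hg : BoundedMeasurable g) :
    BoundedMeasurable (fun x => f x - g x) := by
  have := hf.add ((const (-1)).mul hg)
  simpa [sub_eq_add_neg] using this

lemma exp (hf : BoundedMeasurable f) : BoundedMeasurable (fun x => Real.exp (f x)) := by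
  obtain ⟨hm, C, hC⟩ := hf
  refine ⟨hm.exp, Real.exp C, fun x => ?_⟩
  rw [abs_of_pos (Real.exp_pos _)]
  exact Real.exp_le_exp.2 ((le_abs_self _).trans (hC x))

lemma comp (hf : BoundedMeasurable f) {e : β → α} (he : Measurable e) :
    BoundedMeasurable (fun x => f (e x)) :=
  ⟨hf.1.comp he, hf.2.imp fun _ hC x => hC (e x)⟩

end BoundedMeasurable

/-! ### Resampling one coordinate of a product measure -/

lemma eq_of_forall_update {ι : Type*} [Fintype ι] [DecidableEq ι] {α : ι → Type*} {β : Type*}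
    {w : (∀ j, α j) → β}
    (hw : ∀ k x y, w (Function.update x k y) = w x) (x x' : ∀ j, α j) : w x = w x' := by
  have key : ∀ s : Finset ι, w (s.piecewise x x') = w x' := by
    intro s
    induction s using Finset.induction_on with
    | empty => simp
    | insert k s _ ih => rw [Finset.piecewise_insert, hw, ih]
  simpa using key Finset.univ

section Product

variable {ι : Type*} [Fintype ι] [DecidableEq ι] {α : ι → Type*} [∀ i, MeasurableSpace (α i)]
  (μ : ∀ i, Measure (α i)) [∀ i, IsProbabilityMeasure (μ i)]

lemma measurePreserving_update (i : ι) :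
    MeasurePreserving (fun p : (∀ j, α j) × α i => Function.update p.1 i p.2)
      ((Measure.pi μ).prod (μ i)) (Measure.pi μ) := by
  refine ⟨measurable_update', (Measure.pi_eq fun s hs => ?_).symm⟩
  rw [Measure.map_apply measurable_update' (MeasurableSet.univ_pi hs)]
  have : (fun p : (∀ j, α j) × α i => Function.update p.1 i p.2) ⁻¹' Set.univ.pi s
      = (Set.univ.pi (Function.update s i Set.univ)) ×ˢ s i := by
    ext ⟨x, y⟩
    simp only [Set.mem_preimage, Set.mem_univ_pi, Set.mem_prod]
    constructor
    · intro h
      refine ⟨fun j => ?_, by simpa using h i⟩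
      by_cases hj : j = i
      · subst hj; simp
      · simpa [hj] using h j
    · rintro ⟨h, hy⟩ j
      by_cases hj : j = i
      · subst hj; simpa using hy
      · simpa [hj] using h j
  rw [this, Measure.prod_prod, Measure.pi_pi, ← Finset.mul_prod_erase _ _ (Finset.mem_univ i),
    ← Finset.mul_prod_erase (a := i) Finset.univ (fun j => μ j (s j)) (Finset.mem_univ i)]
  simp only [Function.update_self, measure_univ, one_mul]
  rw [mul_comm]
  congr 1
  refine Finset.prod_congr rfl fun j hj => ?_
  rw [Function.update_of_ne (Finset.ne_of_mem_erase hj)]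

lemma integral_integral_update (i : ι) {f : (∀ j, α j) → ℝ} (hf : BoundedMeasurable f) :
    ∫ x, ∫ y, f (Function.update x i y) ∂μ i ∂Measure.pi μ = ∫ x, f x ∂Measure.pi μ := by
  rw [← (measurePreserving_update μ i).map_eq, integral_map measurable_update'.aemeasurable
    hf.1.aestronglyMeasurable, (measurePreserving_update μ i).map_eq,
    integral_prod _ ((hf.comp measurable_update').integrable _)]

lemma ae_ae_update (i : ι) {p : (∀ j, α j) → Prop} (hp : ∀ᵐ x ∂Measure.pi μ, p x) :
    ∀ᵐ x ∂Measure.pi μ, ∀ᵐ y ∂μ i, p (Function.update x i y) :=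
  Measure.ae_ae_of_ae_prod ((measurePreserving_update μ i).quasiMeasurePreserving.ae hp)

/-! ### Tensorization of the entropy -/

/-- Integrating out the coordinates in `s` one by one turns `exp F` into `exp w`; each integration
costs at most one term of the sum. The bound on a single step is `t + 1 ≤ exp t`, together with the
fact that `exp (w - w')`, the ratio of two successive marginals, has integral one in the coordinate
just integrated out, on which `g k` does not depend. -/
lemma exists_marginal_entropy_le {F : (∀ j, α j) → ℝ} (hF : BoundedMeasurable F)
    {g : ι → (∀ j, α j) → ℝ} (hg : ∀ k, BoundedMeasurable (g k))
    (hgk : ∀ k x y, g k (Function.update x k y) = g k x) (s : Finset ι) :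
    ∃ w : (∀ j, α j) → ℝ, BoundedMeasurable w ∧
      (∀ k ∈ s, ∀ x y, w (Function.update x k y) = w x) ∧
      ∫ x, Real.exp (w x) ∂Measure.pi μ = ∫ x, Real.exp (F x) ∂Measure.pi μ ∧
      ∫ x, Real.exp (F x) * (F x - w x) ∂Measure.pi μ ≤
        ∑ k ∈ s, ∫ x, (Real.exp (F x) * (F x - g k x) - Real.exp (F x) + Real.exp (g k x))
          ∂Measure.pi μ := by
  induction s using Finset.induction_on with
  | empty => exact ⟨F, hF, by simp, rfl, by simp⟩
  | insert k s hk ih =>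
    obtain ⟨w, hw, hws, hwint, hwle⟩ := ih
    set W : (∀ j, α j) → ℝ := fun x => ∫ y, Real.exp (w (Function.update x k y)) ∂μ k with hW
    have hmeas : Measurable W := by
      have : StronglyMeasurable (fun p : (∀ j, α j) × α k =>
          Real.exp (w (Function.update p.1 k p.2))) :=
        (hw.exp.comp measurable_update').1.stronglyMeasurable
      exact this.integral_prod_right'.measurable
    have hint : ∀ x, Integrable (fun y => Real.exp (w (Function.update x k y))) (μ k) :=
      fun x => (hw.exp.comp (measurable_update x)).integrable _
    obtain ⟨C, hC⟩ := hw.2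
    have hlow : ∀ x, Real.exp (-C) ≤ W x := fun x => by
      have := integral_mono (μ := μ k) (integrable_const (Real.exp (-C))) (hint x)
        (fun y => Real.exp_le_exp.2 (abs_le.1 (hC _)).1)
      simpa using this
    have hupp : ∀ x, W x ≤ Real.exp C := fun x => by
      have := integral_mono (μ := μ k) (hint x) (integrable_const (Real.exp C))
        (fun y => Real.exp_le_exp.2 (abs_le.1 (hC _)).2)
      simpa using this
    have hpos : ∀ x, 0 < W x := fun x => (Real.exp_pos _).trans_le (hlow x)
    have hw' : BoundedMeasurable (fun x => Real.log (W x)) := by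
      refine ⟨hmeas.log, C, fun x => abs_le.2 ⟨?_, ?_⟩⟩
      · exact (Real.le_log_iff_exp_le (hpos x)).2 (hlow x)
      · exact (Real.log_le_iff_le_exp (hpos x)).2 (hupp x)
    have hWk : ∀ x y, W (Function.update x k y) = W x := fun x y => by simp [hW]
    refine ⟨fun x => Real.log (W x), hw', ?_, ?_, ?_⟩
    · intro j hj x y
      rcases Finset.mem_insert.1 hj with rfl | hj
      · simp only [hWk]
      · have hjk : j ≠ k := fun h => hk (h ▸ hj)
        simp only [hW, Function.update_comm hjk, hws j hj]
    · simp only [Real.exp_log (hpos _)]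
      rw [← hwint, hW, integral_integral_update μ k hw.exp]
    · have hratio : ∫ x, Real.exp (g k x + w x - Real.log (W x)) ∂Measure.pi μ
          = ∫ x, Real.exp (g k x) ∂Measure.pi μ := by
        rw [← integral_integral_update μ k (((hg k).add hw).sub hw').exp]
        refine integral_congr_ae (Filter.Eventually.of_forall fun x => ?_)
        simp only [hgk, hWk]
        have : ∀ y, Real.exp (g k x + w (Function.update x k y) - Real.log (W x))
            = Real.exp (g k x) / W x * Real.exp (w (Function.update x k y)) := fun y => by
          rw [Real.exp_sub, Real.exp_add, Real.exp_log (hpos x)]; ring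
        simp only [this]
        rw [integral_const_mul]
        exact div_mul_cancel₀ _ (hpos x).ne'
      rw [Finset.sum_insert hk, add_comm]
      have h1 : BoundedMeasurable fun x => Real.exp (F x) * (F x - w x) := hF.exp.mul (hF.sub hw)
      have h2 : BoundedMeasurable fun x => Real.exp (F x) * (w x - Real.log (W x)) :=
        hF.exp.mul (hw.sub hw')
      have h3 : BoundedMeasurable fun x => Real.exp (F x) * (F x - g k x) - Real.exp (F x) :=
        (hF.exp.mul (hF.sub (hg k))).sub hF.exp
      have h4 : BoundedMeasurable fun x => Real.exp (g k x + w x - Real.log (W x)) :=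
        (((hg k).add hw).sub hw').exp
      have hsplit : ∫ x, Real.exp (F x) * (F x - Real.log (W x)) ∂Measure.pi μ
          = ∫ x, Real.exp (F x) * (F x - w x) ∂Measure.pi μ
            + ∫ x, Real.exp (F x) * (w x - Real.log (W x)) ∂Measure.pi μ := by
        rw [← integral_add (h1.integrable _) (h2.integrable _)]
        exact integral_congr_ae (Filter.Eventually.of_forall fun x => by ring)
      rw [hsplit]
      refine add_le_add hwle ?_
      rw [integral_add (h3.integrable _) ((hg k).exp.integrable _), ← hratio,
        ← integral_add (h3.integrable _) (h4.integrable _)]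
      refine integral_mono (h2.integrable _) ((h3.add h4).integrable _) fun x => ?_
      have hexp : Real.exp (g k x + w x - Real.log (W x))
          = Real.exp (F x) * Real.exp (g k x + w x - Real.log (W x) - F x) := by
        rw [← Real.exp_add]; congr 1; ring
      have := mul_le_mul_of_nonneg_left
        (Real.add_one_le_exp (g k x + w x - Real.log (W x) - F x)) (Real.exp_pos (F x)).le
      simp only [hexp]
      linarith

/-- Tensorization of the entropy of `exp F`, with the entropy in the coordinate `k` already bounded
through its variational formula: `g k` is any function which does not depend on that coordinate. -/
theorem entropy_exp_le_sum {F : (∀ j, α j) → ℝ} (hF : BoundedMeasurable F)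
    {g : ι → (∀ j, α j) → ℝ} (hg : ∀ k, BoundedMeasurable (g k))
    (hgk : ∀ k x y, g k (Function.update x k y) = g k x) :
    ∫ x, Real.exp (F x) * F x ∂Measure.pi μ
        - (∫ x, Real.exp (F x) ∂Measure.pi μ) * Real.log (∫ x, Real.exp (F x) ∂Measure.pi μ) ≤
      ∫ x, ∑ k, (Real.exp (F x) * (F x - g k x) - Real.exp (F x) + Real.exp (g k x))
        ∂Measure.pi μ := by
  obtain ⟨w, hw, hwk, hwint, hwle⟩ := exists_marginal_entropy_le μ hF hg hgk Finset.univ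
  obtain ⟨x₀⟩ : Nonempty (∀ j, α j) := (Measure.pi μ).nonempty_of_neZero
  have hconst : ∀ x, w x = w x₀ :=
    fun x => eq_of_forall_update (fun k x y => hwk k (Finset.mem_univ k) x y) x x₀
  have hlog : Real.log (∫ x, Real.exp (F x) ∂Measure.pi μ) = w x₀ := by
    rw [← hwint]; simp [hconst]
  rw [integral_finsetSum _ fun k _ =>
    (((hF.exp.mul (hF.sub (hg k))).sub hF.exp).add (hg k).exp).integrable _]
  refine le_trans (le_of_eq ?_) hwle
  rw [hlog, ← integral_mul_const, ← integral_sub ((hF.exp.mul hF).integrable _)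
    ((hF.exp.mul (BoundedMeasurable.const _)).integrable _)]
  refine integral_congr_ae (Filter.Eventually.of_forall fun x => ?_)
  simp only [hconst x]; ring

end Product

/-! ### The entropy inequality for self-bounding functions -/

section EssInf

variable {ι : Type*} [DecidableEq ι] {α : ι → Type*} [∀ i, MeasurableSpace (α i)]
  (μ : ∀ i, Measure (α i))

/-- The essential infimum of `f` over its `k`-th coordinate, the other ones being frozen. It is the
largest function not depending on the coordinate `k` which is almost surely below `f`, and it is
measurable, unlike an arbitrary such function. -/
noncomputable def coordEssInf (f : (∀ j, α j) → ℝ) (k : ι) (x : ∀ j, α j) : ℝ :=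
  essInf (fun y => f (Function.update x k y)) (μ k)

variable {μ} {f : (∀ j, α j) → ℝ}

lemma coordEssInf_update (k : ι) (x : ∀ j, α j) (y : α k) :
    coordEssInf μ f k (Function.update x k y) = coordEssInf μ f k x := by
  simp [coordEssInf]

lemma coordEssInf_ae_le {C : ℝ} (hC : ∀ x, |f x| ≤ C) (k : ι) (x : ∀ j, α j) :
    ∀ᵐ y ∂μ k, coordEssInf μ f k x ≤ f (Function.update x k y) :=
  ae_essInf_le ⟨-C, Filter.eventually_map.2
    (Filter.Eventually.of_forall fun _ => (abs_le.1 (hC _)).1)⟩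

variable [∀ i, IsProbabilityMeasure (μ i)]

lemma le_coordEssInf {C : ℝ} (hC : ∀ x, |f x| ≤ C) {k : ι} {x : ∀ j, α j} {c : ℝ}
    (h : ∀ᵐ y ∂μ k, c ≤ f (Function.update x k y)) : c ≤ coordEssInf μ f k x := by
  refine Filter.le_liminf_of_le ?_ h
  have : Filter.IsBoundedUnder (· ≤ ·) (ae (μ k)) fun y => f (Function.update x k y) :=
    ⟨C, Filter.eventually_map.2 (Filter.Eventually.of_forall fun _ => (abs_le.1 (hC _)).2)⟩
  exact this.isCoboundedUnder_ge

lemma boundedMeasurable_coordEssInf (hf : BoundedMeasurable f) (k : ι) :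
    BoundedMeasurable (coordEssInf μ f k) := by
  obtain ⟨hm, C, hC⟩ := hf
  refine ⟨measurable_of_Ici fun c => ?_, C, fun x => abs_le.2 ⟨?_, ?_⟩⟩
  · have hset : coordEssInf μ f k ⁻¹' Set.Ici c
        = (fun x => μ k (Prod.mk x ⁻¹' {p : (∀ j, α j) × α k |
            f (Function.update p.1 k p.2) < c})) ⁻¹' {0} := by
      ext x
      have : c ≤ coordEssInf μ f k x ↔ ∀ᵐ y ∂μ k, c ≤ f (Function.update x k y) :=
        ⟨fun h => (coordEssInf_ae_le hC k x).mono fun y hy => h.trans hy, le_coordEssInf hC⟩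
      simp only [Set.mem_preimage, Set.mem_Ici, this, ae_iff, not_le, Set.mem_singleton_iff]
      rfl
    rw [hset]
    exact measurable_measure_prodMk_left
      (measurableSet_lt (hm.comp measurable_update') measurable_const) (measurableSet_singleton 0)
  · exact le_coordEssInf hC (Filter.Eventually.of_forall fun _ => (abs_le.1 (hC _)).1)
  · obtain ⟨y, hy⟩ := (coordEssInf_ae_le (μ := μ) hC k x).exists
    exact hy.trans (abs_le.1 (hC _)).2

variable [Fintype ι]

lemma ae_coordEssInf_le (hf : BoundedMeasurable f) (k : ι) :
    ∀ᵐ x ∂Measure.pi μ, coordEssInf μ f k x ≤ f x := by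
  obtain ⟨C, hC⟩ := hf.2
  rw [← (measurePreserving_update μ k).map_eq, ae_map_iff measurable_update'.aemeasurable
    (measurableSet_le (boundedMeasurable_coordEssInf hf k).1 hf.1)]
  refine (Measure.ae_prod_iff_ae_ae ?_).2 (Filter.Eventually.of_forall fun x => ?_)
  · exact measurableSet_le ((boundedMeasurable_coordEssInf hf k).1.comp measurable_update')
      (hf.1.comp measurable_update')
  · simpa only [coordEssInf_update] using coordEssInf_ae_le hC k x

end EssInf

/-- Convexity of the exponential, on the chord from `0` to `-l`. -/
lemma exp_neg_mul_le_chord {v : ℝ} (hv₀ : 0 ≤ v) (hv₁ : v ≤ 1) (l : ℝ) :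
    Real.exp (-(l * v)) + l * v - 1 ≤ v * (Real.exp (-l) + l - 1) := by
  have := convexOn_exp.2 (Set.mem_univ (-l)) (Set.mem_univ 0) hv₀ (sub_nonneg.2 hv₁) (by ring)
  simp only [smul_eq_mul, mul_zero, add_zero, Real.exp_zero, mul_one] at this
  rw [show v * -l = -(l * v) by ring] at this
  linarith

/-- The logarithmic Sobolev inequality satisfied by a self-bounding function under a product
measure, for parameters `l` of either sign. The functions that witness the self-bounding property
need not be measurable: the coordinatewise essential infima of `f` dominate them, hence
satisfy the same inequalities almost surely. -/
theorem IsSelfBounding.entropy_le {E : Type*} [MeasurableSpace E] {n : ℕ}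
    (μ : Fin n → Measure E) [∀ i, IsProbabilityMeasure (μ i)] {a b : ℝ} {f : (Fin n → E) → ℝ}
    (hf : IsSelfBounding a b f) (hmeas : AEMeasurable f (Measure.pi μ)) {C : ℝ}
    (hC : ∀ x, |f x| ≤ C) (l : ℝ) :
    l * ∫ x, f x * Real.exp (l * f x) ∂Measure.pi μ
        - (∫ x, Real.exp (l * f x) ∂Measure.pi μ)
          * Real.log (∫ x, Real.exp (l * f x) ∂Measure.pi μ) ≤
      (Real.exp (-l) + l - 1) * ∫ x, (a * f x + b) * Real.exp (l * f x) ∂Measure.pi μ := by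
  obtain ⟨F, hF⟩ := hf
  -- a version of `f` which is measurable and everywhere bounded
  obtain ⟨f', hf', hC', hff'⟩ : ∃ f' : (Fin n → E) → ℝ, BoundedMeasurable f' ∧
      (∀ x, |f' x| ≤ C) ∧ f =ᵐ[Measure.pi μ] f' := by
    obtain ⟨x₀⟩ : Nonempty (Fin n → E) := (Measure.pi μ).nonempty_of_neZero
    have hC0 : 0 ≤ C := (abs_nonneg _).trans (hC x₀)
    have hb : ∀ x, |max (-C) (min C (hmeas.mk f x))| ≤ C := fun x =>
      abs_le.2 ⟨le_max_left _ _, max_le (by linarith) (min_le_left _ _)⟩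
    refine ⟨fun x => max (-C) (min C (hmeas.mk f x)),
      ⟨measurable_const.max (measurable_const.min hmeas.measurable_mk), C, hb⟩, hb, ?_⟩
    filter_upwards [hmeas.ae_eq_mk] with x hx
    rw [← hx, min_eq_right (abs_le.1 (hC x)).2, max_eq_right (abs_le.1 (hC x)).1]
  set g : Fin n → (Fin n → E) → ℝ := fun k x => coordEssInf μ f' k x
  have hg : ∀ k, BoundedMeasurable (g k) := fun k => boundedMeasurable_coordEssInf hf' k
  have hlg : ∀ k, BoundedMeasurable fun x => l * g k x :=
    fun k => (BoundedMeasurable.const l).mul (hg k)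
  have hlf : BoundedMeasurable fun x => l * f' x := (BoundedMeasurable.const l).mul hf'
  have hent := entropy_exp_le_sum μ hlf hlg
    (fun k x y => by simp only [g, coordEssInf_update])
  have hL : ∫ x, Real.exp (l * f' x) * (l * f' x) ∂Measure.pi μ
      = l * ∫ x, f x * Real.exp (l * f x) ∂Measure.pi μ := by
    rw [← integral_const_mul]
    refine integral_congr_ae (hff'.mono fun x hx => ?_)
    simp only [hx]; ring
  have hZ : ∫ x, Real.exp (l * f' x) ∂Measure.pi μ = ∫ x, Real.exp (l * f x) ∂Measure.pi μ :=
    integral_congr_ae (hff'.mono fun x hx => by simp only [hx])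
  have hR : ∫ x, (Real.exp (-l) + l - 1) * ((a * f' x + b) * Real.exp (l * f' x)) ∂Measure.pi μ
      = (Real.exp (-l) + l - 1) * ∫ x, (a * f x + b) * Real.exp (l * f x) ∂Measure.pi μ := by
    rw [← integral_const_mul]
    exact integral_congr_ae (hff'.mono fun x hx => by simp only [hx])
  rw [hL, hZ] at hent
  rw [← hR]
  refine hent.trans (integral_mono_ae ?_ ?_ ?_)
  · exact integrable_finsetSum _ fun k _ =>
      (((hlf.exp.mul (hlf.sub (hlg k))).sub hlf.exp).add (hlg k).exp).integrable _
  · exact ((BoundedMeasurable.const _).mul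
      ((((BoundedMeasurable.const a).mul hf').add (BoundedMeasurable.const b)).mul
        hlf.exp)).integrable _
  · have hfib : ∀ᵐ x ∂Measure.pi μ, ∀ k, ∀ᵐ y ∂μ k,
        f (Function.update x k y) = f' (Function.update x k y) :=
      ae_all_iff.2 fun k => ae_ae_update μ k hff'
    have hle : ∀ᵐ x ∂Measure.pi μ, ∀ k, g k x ≤ f' x :=
      ae_all_iff.2 fun k => ae_coordEssInf_le hf' k
    filter_upwards [hff', hfib, hle] with x hx hfibx hlex
    have hFg : ∀ k, F k (fun j => x j) ≤ g k x := fun k => by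
      refine le_coordEssInf hC' ((hfibx k).mono fun y hy => ?_)
      rw [← hy]
      have h0 := ((hF (Function.update x k y)).1 k).1
      have : (fun j : {j : Fin n // j ≠ k} => Function.update x k y j)
          = fun j : {j : Fin n // j ≠ k} => x j :=
        funext fun j => Function.update_of_ne j.2 _ _
      rw [this] at h0
      linarith
    have hterm : ∀ k, Real.exp (l * f' x) * (l * f' x - l * g k x) - Real.exp (l * f' x)
        + Real.exp (l * g k x)
        ≤ Real.exp (l * f' x) * ((f x - F k (fun j => x j)) * (Real.exp (-l) + l - 1)) := by
      intro k
      have hv₁ : f' x - g k x ≤ f x - F k (fun j => x j) := by linarith [hFg k]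
      have hchord := exp_neg_mul_le_chord (sub_nonneg.2 (hlex k))
        (hv₁.trans ((hF x).1 k).2) l
      have hφ : 0 ≤ Real.exp (-l) + l - 1 := by linarith [Real.add_one_le_exp (-l)]
      have h1 := mul_le_mul_of_nonneg_left (hchord.trans (mul_le_mul_of_nonneg_right hv₁ hφ))
        (Real.exp_pos (l * f' x)).le
      have h2 : Real.exp (l * g k x)
          = Real.exp (l * f' x) * Real.exp (-(l * (f' x - g k x))) := by
        rw [← Real.exp_add]; congr 1; ring
      rw [h2]
      linarith
    refine (Finset.sum_le_sum fun k _ => hterm k).trans ?_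
    rw [← Finset.mul_sum, ← Finset.sum_mul]
    have hφ : 0 ≤ Real.exp (-l) + l - 1 := by linarith [Real.add_one_le_exp (-l)]
    have h1 := mul_le_mul_of_nonneg_left (mul_le_mul_of_nonneg_right (hF x).2 hφ)
      (Real.exp_pos (l * f' x)).le
    rw [hx] at h1 ⊢
    linarith

/-! ### Comparison for the cumulant generating function -/

lemma exp_neg_le_quadratic {l : ℝ} (hl : 0 ≤ l) : Real.exp (-l) + l - 1 ≤ l ^ 2 / 2 := by
  have h1 := Real.quadratic_le_exp_of_nonneg hl
  have h2 : Real.exp (-l) * Real.exp l = 1 := by rw [← Real.exp_add]; simp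
  have h3 := mul_le_mul_of_nonneg_left h1 (Real.exp_pos (-l)).le
  rw [h2] at h3
  have h4 : 0 < 1 + l + l ^ 2 / 2 := by positivity
  -- `(1 - l + l² / 2) (1 + l + l² / 2) = 1 + l⁴ / 4`
  have h5 : Real.exp (-l) * (1 + l + l ^ 2 / 2)
      ≤ (1 - l + l ^ 2 / 2) * (1 + l + l ^ 2 / 2) := by nlinarith [sq_nonneg (l ^ 2)]
  have := le_of_mul_le_mul_right h5 h4
  linarith

lemma one_sub_mul_exp_le_quadratic {t : ℝ} (ht : 0 ≤ t) :
    (1 - t) * (Real.exp t - t - 1) ≤ t ^ 2 / 2 := by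
  have hd : ∀ s : ℝ, HasDerivAt (fun s => s ^ 2 / 2 - (1 - s) * (Real.exp s - s - 1))
      (s * (Real.exp s - 1)) s := by
    intro s
    have h := (((hasDerivAt_id s).pow 2).div_const 2).sub
      (((hasDerivAt_const s (1 : ℝ)).sub (hasDerivAt_id s)).mul
        (((Real.hasDerivAt_exp s).sub (hasDerivAt_id s)).sub (hasDerivAt_const s (1 : ℝ))))
    refine (h.congr_deriv ?_)
    simp
    ring
  have hmono : MonotoneOn (fun s : ℝ => s ^ 2 / 2 - (1 - s) * (Real.exp s - s - 1))
      (Set.Ici 0) := by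
    refine monotoneOn_of_deriv_nonneg (convex_Ici 0)
      (fun s _ => (hd s).continuousAt.continuousWithinAt)
      (fun s _ => (hd s).differentiableAt.differentiableWithinAt) fun s hs => ?_
    rw [interior_Ici, Set.mem_Ioi] at hs
    rw [(hd s).deriv]
    exact mul_nonneg hs.le (by linarith [Real.add_one_le_exp s])
  have := hmono Set.self_mem_Ici (Set.mem_Ici.2 ht) ht
  simp at this
  linarith

/-- A function which vanishes to second order at `0` and whose logarithmic derivative, where the
function is positive, is at most that of `x * exp (M * x)`, is nowhere positive. -/
lemma nonpos_of_deriv_le_mul {D D' : ℝ → ℝ} {L M : ℝ} (hL : 0 ≤ L)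
    (hD : ∀ x ∈ Set.Icc 0 L, HasDerivAt D (D' x) x) (h0 : D 0 = 0) (h0' : D' 0 = 0)
    (h : ∀ x ∈ Set.Ioo 0 L, 0 < D x → D' x ≤ D x * (1 / x + M)) : D L ≤ 0 := by
  have key : ∀ ε > 0, D L ≤ ε * (L * Real.exp ((M + 1) * L)) := by
    intro ε hε
    have hB : ∀ x : ℝ, HasDerivAt (fun x => ε * (x * Real.exp ((M + 1) * x)))
        (ε * ((1 + (M + 1) * x) * Real.exp ((M + 1) * x))) x := by
      intro x
      have h1 : HasDerivAt (fun x : ℝ => (M + 1) * x) (M + 1) x := by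
        simpa using (hasDerivAt_id x).const_mul (M + 1)
      have := ((hasDerivAt_id x).mul h1.exp).const_mul ε
      refine this.congr_deriv ?_
      simp only [id]; ring
    refine image_le_of_deriv_right_lt_deriv_boundary (a := 0) (b := L)
      (B := fun x => ε * (x * Real.exp ((M + 1) * x)))
      (fun x hx => (hD x hx).continuousAt.continuousWithinAt)
      (fun x hx => (hD x (Set.Ico_subset_Icc_self hx)).hasDerivWithinAt) (by simp [h0]) hB ?_
      (Set.right_mem_Icc.2 hL)
    intro x hx hxB
    rcases hx.1.eq_or_lt with rfl | hx0
    · rw [h0']; simpa using hε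
    · have hpos : 0 < ε * (x * Real.exp ((M + 1) * x)) := by positivity
      have hle := h x ⟨hx0, hx.2⟩ (by rw [hxB]; exact hpos)
      refine hle.trans_lt ?_
      rw [hxB]
      have : ε * (x * Real.exp ((M + 1) * x)) * (1 / x + M)
          = ε * ((1 + M * x) * Real.exp ((M + 1) * x)) := by field_simp
      rw [this]
      have : 0 < ε * (x * Real.exp ((M + 1) * x)) := hpos
      nlinarith
  by_contra! hcon
  rcases hL.eq_or_lt with rfl | hL0
  · exact hcon.ne' h0
  · have hK : 0 < L * Real.exp ((M + 1) * L) := by positivity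
    have := key (D L / (L * Real.exp ((M + 1) * L)) / 2) (by positivity)
    rw [div_div, mul_comm _ (2 : ℝ), ← div_div, div_mul_cancel₀ _ hK.ne'] at this
    linarith

section Comparison

variable {ψ ψ' : ℝ → ℝ} {a b m : ℝ}

/-- Comparison on the right of the origin, against the exact solution
`(a * m + b) * l ^ 2 / (2 * (1 - a / 2 * l))` of the differential equation in which
`exp (-l) + l - 1` is replaced by `l ^ 2 / 2`. -/
lemma le_of_entropy_ode_right (ha : 0 ≤ a) (hv : 0 ≤ a * m + b)
    (hψ : ∀ l, HasDerivAt ψ (ψ' l) l) (h0 : ψ 0 = 0) (h0' : ψ' 0 = m)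
    (hode : ∀ l, l * ψ' l - ψ l ≤ (Real.exp (-l) + l - 1) * (a * ψ' l + b))
    {l : ℝ} (hl : 0 ≤ l) (hl' : a / 2 * l < 1) :
    ψ l ≤ l * m + (a * m + b) * l ^ 2 / (2 * (1 - a / 2 * l)) := by
  set c := a / 2 with hc
  have hac : a = 2 * c := by rw [hc]; ring
  have hc0 : 0 ≤ c := by positivity
  have hden : ∀ s ∈ Set.Icc 0 l, 0 < 1 - c * s := fun s hs => by
    have := mul_le_mul_of_nonneg_left hs.2 hc0
    linarith
  suffices h : (fun s => ψ s - s * m - (a * m + b) * (s ^ 2 / (2 * (1 - c * s)))) l ≤ 0 by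
    have := h
    simp only [← mul_div_assoc] at this
    linarith
  refine nonpos_of_deriv_le_mul (M := c / (1 - c * l))
    (D := fun s => ψ s - s * m - (a * m + b) * (s ^ 2 / (2 * (1 - c * s)))) (D' := fun s => ψ' s - m
    - (a * m + b) * ((s - c * s ^ 2 / 2) / (1 - c * s) ^ 2)) hl ?_ ?_ ?_ ?_
  · intro s hs
    have hs0 := hden s hs
    have h1 : HasDerivAt (fun s : ℝ => s ^ 2) (2 * s) s := by simpa using hasDerivAt_pow 2 s
    have h2 : HasDerivAt (fun s : ℝ => 2 * (1 - c * s)) (2 * -c) s := by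
      have := (((hasDerivAt_id s).const_mul c).const_sub 1).const_mul 2
      simpa using this
    have h3 := ((hψ s).sub ((hasDerivAt_id s).mul_const m)).sub
      ((h1.div h2 (by positivity)).const_mul (a * m + b))
    refine h3.congr_deriv ?_
    simp only [one_mul]
    congr 2
    field_simp
    ring
  · simp [h0]
  · simp [h0']
  · intro s hs hpos
    have hs0 := hden s (Set.Ioo_subset_Icc_self hs)
    have hl0 := hden l (Set.right_mem_Icc.2 hl)
    have hode' := hode s
    have hφ2 := exp_neg_le_quadratic hs.1.le
    have hφ0 : 0 ≤ Real.exp (-s) + s - 1 := by linarith [Real.add_one_le_exp (-s)]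
    set φ := Real.exp (-s) + s - 1
    set H := s ^ 2 / (2 * (1 - c * s)) with hH
    set H' := (s - c * s ^ 2 / 2) / (1 - c * s) ^ 2 with hH'
    have hne : 1 - s * c ≠ 0 := by rw [mul_comm]; exact hs0.ne'
    -- the identity which singles out the comparison function
    have hsuper : φ ≤ (s - a * φ) * H' - H := by
      have : (s - a * φ) * H' - H - φ = (s ^ 2 / 2 - φ) / (1 - c * s) ^ 2 := by
        rw [hH, hH', hac]
        field_simp
        ring
      have h2 : 0 ≤ (s ^ 2 / 2 - φ) / (1 - c * s) ^ 2 :=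
        div_nonneg (by linarith) (by positivity)
      linarith
    have hpD : (s - a * φ) * (ψ' s - m - (a * m + b) * H')
        ≤ ψ s - s * m - (a * m + b) * H := by
      have := mul_le_mul_of_nonneg_left hsuper hv
      linarith
    have hp : s * (1 - c * s) ≤ s - a * φ := by
      have := mul_le_mul_of_nonneg_left hφ2 ha
      rw [hac] at this ⊢
      linarith
    have hp0 : 0 < s * (1 - c * s) := mul_pos hs.1 hs0
    have hD : 0 < ψ s - s * m - (a * m + b) * H := hpos
    change ψ' s - m - (a * m + b) * H' ≤ (ψ s - s * m - (a * m + b) * H) * _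
    have hle : ψ' s - m - (a * m + b) * H'
        ≤ (ψ s - s * m - (a * m + b) * H) / (s - a * φ) := by
      rw [le_div_iff₀ (hp0.trans_le hp)]; linarith
    refine hle.trans ((div_le_div_of_nonneg_left hD.le hp0 hp).trans ?_)
    rw [div_eq_mul_one_div]
    refine mul_le_mul_of_nonneg_left ?_ hD.le
    have hs1 := hs.1
    have : 1 / (s * (1 - c * s)) = 1 / s + c / (1 - c * s) := by
      field_simp
      ring
    rw [this]
    refine add_le_add le_rfl (div_le_div_of_nonneg_left hc0 hl0 ?_)
    have := mul_le_mul_of_nonneg_left hs.2.le hc0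
    linarith

/-- Comparison on the left of the origin. The excess of `exp t - t - 1` over `t ^ 2 / 2` is absorbed
by the term `a * ψ'`: as `a` is at least one, `(1 - a * t) * (exp t - t - 1) ≤ t ^ 2 / 2`, so the
purely quadratic bound holds for all `t`. -/
lemma le_of_entropy_ode_left (ha : 1 ≤ a) (hv : 0 ≤ a * m + b)
    (hψ : ∀ l, HasDerivAt ψ (ψ' l) l) (h0 : ψ 0 = 0) (h0' : ψ' 0 = m)
    (hode : ∀ l, l * ψ' l - ψ l ≤ (Real.exp (-l) + l - 1) * (a * ψ' l + b))
    {t : ℝ} (ht : 0 ≤ t) :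
    ψ (-t) ≤ -t * m + (a * m + b) * t ^ 2 / 2 := by
  suffices h : (fun s => ψ (-s) + s * m - (a * m + b) * (s ^ 2 / 2)) t ≤ 0 by
    have := h
    simp only at this
    linarith
  refine nonpos_of_deriv_le_mul (M := 0)
    (D := fun s => ψ (-s) + s * m - (a * m + b) * (s ^ 2 / 2)) (D' := fun s => -ψ' (-s) + m - (a * m + b) * s)
    ht ?_ ?_ ?_ ?_
  · intro s _
    have h1 : HasDerivAt (fun s : ℝ => s ^ 2 / 2) s s := by
      have := (hasDerivAt_pow 2 s).div_const 2
      simpa using this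
    have h2 : HasDerivAt (fun s => ψ (-s)) (-ψ' (-s)) s := by
      have := (hψ (-s)).scomp s (hasDerivAt_neg s)
      simpa [Function.comp_def] using this
    have h3 := (h2.add ((hasDerivAt_id s).mul_const m)).sub (h1.const_mul (a * m + b))
    refine h3.congr_deriv ?_
    simp
  · simp [h0]
  · simp [h0']
  · intro s hs hpos
    have hs1 := hs.1
    have hode' := hode (-s)
    rw [neg_neg] at hode'
    have hφ2 := one_sub_mul_exp_le_quadratic hs1.le
    have hφ0 : 0 ≤ Real.exp s - s - 1 := by linarith [Real.add_one_le_exp s]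
    have hφe : Real.exp s + -s - 1 = Real.exp s - s - 1 := by ring
    rw [hφe] at hode'
    set φ := Real.exp s - s - 1
    have hquad : (1 - a * s) * φ ≤ s ^ 2 / 2 := by
      refine le_trans (mul_le_mul_of_nonneg_right ?_ hφ0) hφ2
      nlinarith
    have hrD : (s + a * φ) * (-ψ' (-s) + m - (a * m + b) * s)
        ≤ ψ (-s) + s * m - (a * m + b) * (s ^ 2 / 2) := by
      have := mul_le_mul_of_nonneg_left hquad hv
      linarith
    have hr : s ≤ s + a * φ := le_add_of_nonneg_right (mul_nonneg (by linarith) hφ0)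
    have hD : 0 < ψ (-s) + s * m - (a * m + b) * (s ^ 2 / 2) := hpos
    change -ψ' (-s) + m - (a * m + b) * s ≤ (ψ (-s) + s * m - (a * m + b) * (s ^ 2 / 2)) * _
    have hle : -ψ' (-s) + m - (a * m + b) * s
        ≤ (ψ (-s) + s * m - (a * m + b) * (s ^ 2 / 2)) / (s + a * φ) := by
      rw [le_div_iff₀ (hs1.trans_le hr)]; linarith
    refine hle.trans ((div_le_div_of_nonneg_left hD.le hs1 hr).trans (le_of_eq ?_))
    ring

end Comparison

/-! ### Concentration of self-bounding functions -/

section Concentration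

lemma IsSelfBounding.nonneg {E : Type*} {n : ℕ} {a b : ℝ} {f : (Fin n → E) → ℝ}
    (hf : IsSelfBounding a b f) (x : Fin n → E) : 0 ≤ a * f x + b := by
  obtain ⟨F, hF⟩ := hf
  exact (Finset.sum_nonneg fun i _ => ((hF x).1 i).1).trans (hF x).2

variable {E : Type*} [MeasurableSpace E] {n : ℕ} (μ : Fin n → Measure E)
  [∀ i, IsProbabilityMeasure (μ i)] {a b : ℝ} {f : (Fin n → E) → ℝ}

lemma IsSelfBounding.integral_nonneg (hf : IsSelfBounding a b f)
    (hint : Integrable f (Measure.pi μ)) : 0 ≤ a * ∫ x, f x ∂Measure.pi μ + b := by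
  have h : 0 ≤ ∫ x, (a * f x + b) ∂Measure.pi μ := MeasureTheory.integral_nonneg hf.nonneg
  rw [integral_add (hint.const_mul a) (integrable_const b), integral_const_mul] at h
  simpa using h

/-- The inequality `IsSelfBounding.entropy_le` divided by the moment generating function. -/
lemma IsSelfBounding.exists_cgf_deriv (hf : IsSelfBounding a b f)
    (hmeas : AEMeasurable f (Measure.pi μ)) {C : ℝ} (hC : ∀ x, |f x| ≤ C) :
    ∃ ψ' : ℝ → ℝ, (∀ l, HasDerivAt (cgf f (Measure.pi μ)) (ψ' l) l) ∧
      ψ' 0 = ∫ x, f x ∂Measure.pi μ ∧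
      ∀ l, l * ψ' l - cgf f (Measure.pi μ) l ≤ (Real.exp (-l) + l - 1) * (a * ψ' l + b) := by
  have hint : ∀ l, Integrable (fun x => Real.exp (l * f x)) (Measure.pi μ) := fun l =>
    integrable_exp_mul_of_mem_Icc hmeas
      (Filter.Eventually.of_forall fun x => abs_le.1 (hC x))
  have hset : ∀ l, l ∈ interior (integrableExpSet f (Measure.pi μ)) := fun l => by
    have : integrableExpSet f (Measure.pi μ) = Set.univ := Set.eq_univ_of_forall hint
    simp [this]
  have hmgf : ∀ l, 0 < mgf f (Measure.pi μ) l := fun l => mgf_pos (hint l)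
  refine ⟨fun l => (∫ x, f x * Real.exp (l * f x) ∂Measure.pi μ) / mgf f (Measure.pi μ) l,
    fun l => (hasDerivAt_mgf (hset l)).log (hmgf l).ne', by simp, fun l => ?_⟩
  have h := hf.entropy_le μ hmeas hC l
  have hfint : Integrable (fun x => f x * Real.exp (l * f x)) (Measure.pi μ) := by
    refine (hint l).bdd_mul hmeas.aestronglyMeasurable (c := C) ?_
    exact Filter.Eventually.of_forall hC
  have hsplit : ∫ x, (a * f x + b) * Real.exp (l * f x) ∂Measure.pi μ
      = a * ∫ x, f x * Real.exp (l * f x) ∂Measure.pi μ + b * mgf f (Measure.pi μ) l := by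
    rw [mgf, ← integral_const_mul, ← integral_const_mul,
      ← integral_add (hfint.const_mul a) ((hint l).const_mul b)]
    exact integral_congr_ae (Filter.Eventually.of_forall fun x => by ring)
  rw [hsplit] at h
  change l * _ - mgf f (Measure.pi μ) l * cgf f (Measure.pi μ) l ≤ _ at h
  have hm := hmgf l
  set I := ∫ x, f x * Real.exp (l * f x) ∂Measure.pi μ
  rw [← mul_le_mul_iff_left₀ hm]
  have e1 : (l * (I / mgf f (Measure.pi μ) l) - cgf f (Measure.pi μ) l) * mgf f (Measure.pi μ) l
      = l * I - mgf f (Measure.pi μ) l * cgf f (Measure.pi μ) l := by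
    field_simp
  have e2 : (Real.exp (-l) + l - 1) * (a * (I / mgf f (Measure.pi μ) l) + b)
      * mgf f (Measure.pi μ) l
      = (Real.exp (-l) + l - 1) * (a * I + b * mgf f (Measure.pi μ) l) := by
    field_simp
  rw [e1, e2]
  exact h

/-- When `a * E f + b` vanishes, a self-bounding function is almost surely constant. -/
lemma IsSelfBounding.ae_eq_integral (hf : IsSelfBounding a b f) (ha : 0 < a)
    (hint : Integrable f (Measure.pi μ)) (hv : a * ∫ x, f x ∂Measure.pi μ + b = 0) :
    ∀ᵐ x ∂Measure.pi μ, f x = ∫ y, f y ∂Measure.pi μ := by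
  have h0 : ∫ x, (a * f x + b) ∂Measure.pi μ = 0 := by
    rw [integral_add (hint.const_mul a) (integrable_const b), integral_const_mul]
    simpa using hv
  have := (integral_eq_zero_iff_of_nonneg (fun x => hf.nonneg x)
    ((hint.const_mul a).add (integrable_const b))).1 h0
  filter_upwards [this] with x hx
  simp only [Pi.zero_apply] at hx
  have : a * (f x - ∫ y, f y ∂Measure.pi μ) = 0 := by linarith
  linarith [(mul_eq_zero.1 this).resolve_left ha.ne']

lemma one_sub_le_measureReal_of_not {Ω : Type*} [MeasurableSpace Ω] (P : Measure Ω)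
    [IsProbabilityMeasure P] {p q : Ω → Prop} {ε : ℝ} (h : P.real {ω | q ω} ≤ ε)
    (hpq : ∀ ω, ¬ p ω → q ω) : 1 - ε ≤ P.real {ω | p ω} := by
  have hcov : (Set.univ : Set Ω) ⊆ {ω | p ω} ∪ {ω | q ω} := fun ω _ => by
    by_cases hp : p ω
    · exact Or.inl hp
    · exact Or.inr (hpq ω hp)
  have h1 := (measureReal_mono hcov (measure_ne_top P _)).trans (measureReal_union_le _ _)
  simp only [probReal_univ] at h1
  linarith

lemma one_sub_le_measureReal_of_ae {Ω : Type*} [MeasurableSpace Ω] (P : Measure Ω)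
    [IsProbabilityMeasure P] {p : Ω → Prop} {ε : ℝ} (hε : 0 ≤ ε) (h : ∀ᵐ ω ∂P, p ω) :
    1 - ε ≤ P.real {ω | p ω} := by
  refine one_sub_le_measureReal_of_not P (q := fun ω => ¬ p ω) ?_ fun _ hω => hω
  rw [measureReal_def, ae_iff.1 h]
  simpa using hε

/-- Upper tail of a self-bounding function of independent variables. -/
theorem IsSelfBounding.upper_tail (hf : IsSelfBounding a b f) (ha : 0 < a)
    (hmeas : AEMeasurable f (Measure.pi μ)) {C : ℝ} (hC : ∀ x, |f x| ≤ C) {x : ℝ} (hx : 0 < x) :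
    1 - Real.exp (-x) ≤ (Measure.pi μ).real {y | f y ≤ ∫ z, f z ∂Measure.pi μ
      + √(2 * (a * ∫ z, f z ∂Measure.pi μ + b) * x) + a / 2 * x} := by
  have hint : Integrable f (Measure.pi μ) :=
    Integrable.of_bound hmeas.aestronglyMeasurable C (Filter.Eventually.of_forall hC)
  have hv := hf.integral_nonneg μ hint
  rcases hv.eq_or_lt with hv0 | hvpos
  · refine one_sub_le_measureReal_of_ae _ (Real.exp_pos _).le ?_
    filter_upwards [hf.ae_eq_integral μ ha hint hv0.symm] with y hy
    rw [← hv0, hy]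
    have : 0 ≤ a / 2 * x := by positivity
    simpa using this
  obtain ⟨ψ', hψ, h0', hode⟩ := hf.exists_cgf_deriv μ hmeas hC
  set m := ∫ z, f z ∂Measure.pi μ
  set v := a * m + b
  -- the optimal parameter in Chernoff's bound for a sub-gamma variable of scale `c = a / 2`
  set c := a / 2
  have hc : 0 < c := by positivity
  set u := √(2 * x / v)
  have hu : 0 ≤ u := Real.sqrt_nonneg _
  have hu2 : u ^ 2 = 2 * x / v := Real.sq_sqrt (by positivity)
  have hvu : v * u ^ 2 = 2 * x := by rw [hu2]; field_simp
  have hsq : √(2 * v * x) = v * u := by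
    rw [show 2 * v * x = (v * u) ^ 2 by linear_combination -v * hvu]
    exact Real.sqrt_sq (by positivity)
  have h1u : 0 < 1 + c * u := by positivity
  set l := u / (1 + c * u) with hl
  have hcl : 1 - c * l = 1 / (1 + c * u) := by rw [hl]; field_simp; ring
  have hl1 : c * l < 1 := by
    have : 0 < 1 / (1 + c * u) := by positivity
    linarith
  have hbd := le_of_entropy_ode_right ha.le hv hψ (by simp) h0' hode (l := l) (by positivity) hl1
  have hH : v * l ^ 2 / (2 * (1 - c * l)) = x / (1 + c * u) := by
    rw [hcl, hl]
    field_simp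
    linarith
  have hch := measure_ge_le_exp_cgf (X := f) (μ := Measure.pi μ) (t := l)
    (m + √(2 * v * x) + c * x) (by positivity) (integrable_exp_mul_of_mem_Icc hmeas
      (Filter.Eventually.of_forall fun x => abs_le.1 (hC x)))
  refine one_sub_le_measureReal_of_not _ (hch.trans (Real.exp_le_exp.2 ?_))
    fun y hy => (not_le.1 hy).le
  change _ ≤ l * m + v * l ^ 2 / (2 * (1 - c * l)) at hbd
  rw [hH] at hbd
  have hlt : l * (v * u + c * x) - x / (1 + c * u) = x := by
    rw [hl]
    field_simp
    linear_combination hvu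
  rw [hsq]
  linarith

/-- Lower tail of a self-bounding function of independent variables. -/
theorem IsSelfBounding.lower_tail (hf : IsSelfBounding a b f) (ha : 1 ≤ a)
    (hmeas : AEMeasurable f (Measure.pi μ)) {C : ℝ} (hC : ∀ x, |f x| ≤ C) {x : ℝ} (hx : 0 < x) :
    1 - Real.exp (-x) ≤ (Measure.pi μ).real {y | ∫ z, f z ∂Measure.pi μ
      - √(2 * (a * ∫ z, f z ∂Measure.pi μ + b) * x) ≤ f y} := by
  have ha0 : 0 < a := by linarith
  have hint : Integrable f (Measure.pi μ) :=
    Integrable.of_bound hmeas.aestronglyMeasurable C (Filter.Eventually.of_forall hC)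
  have hv := hf.integral_nonneg μ hint
  rcases hv.eq_or_lt with hv0 | hvpos
  · refine one_sub_le_measureReal_of_ae _ (Real.exp_pos _).le ?_
    filter_upwards [hf.ae_eq_integral μ ha0 hint hv0.symm] with y hy
    rw [← hv0, hy]
    simp
  obtain ⟨ψ', hψ, h0', hode⟩ := hf.exists_cgf_deriv μ hmeas hC
  set m := ∫ z, f z ∂Measure.pi μ
  set v := a * m + b
  set u := √(2 * x / v)
  have hu : 0 ≤ u := Real.sqrt_nonneg _
  have hu2 : u ^ 2 = 2 * x / v := Real.sq_sqrt (by positivity)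
  have hvu : v * u ^ 2 = 2 * x := by rw [hu2]; field_simp
  have hsq : √(2 * v * x) = v * u := by
    rw [show 2 * v * x = (v * u) ^ 2 by linear_combination -v * hvu]
    exact Real.sqrt_sq (by positivity)
  have hbd := le_of_entropy_ode_left ha hv hψ (by simp) h0' hode hu
  have hch := measure_le_le_exp_cgf (X := f) (μ := Measure.pi μ) (t := -u)
    (m - √(2 * v * x)) (by linarith) (integrable_exp_mul_of_mem_Icc hmeas
      (Filter.Eventually.of_forall fun x => abs_le.1 (hC x)))
  refine one_sub_le_measureReal_of_not _ (hch.trans (Real.exp_le_exp.2 ?_))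
    fun y hy => (not_le.1 hy).le
  change _ ≤ -u * m + v * u ^ 2 / 2 at hbd
  rw [hsq]
  nlinarith

end Concentration

/-! ### The weighted supremum as a function of the weights -/

section WeightedSup

variable {E : Type*} {n : ℕ} {T : Set (E → ℝ)}

lemma abs_sum_mul_le (hT : ∀ t ∈ T, ∀ y, t y ∈ Set.Icc (-1 : ℝ) 1) (x : Fin n → E)
    (w : Fin n → ℝ) (t : T) : |∑ j, w j * (t : E → ℝ) (x j)| ≤ ∑ j, |w j| := by
  refine (Finset.abs_sum_le_sum_abs _ _).trans (Finset.sum_le_sum fun j _ => ?_)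
  rw [abs_mul]
  exact mul_le_of_le_one_right (abs_nonneg _) (abs_le.2 (hT t t.2 (x j)))

lemma sum_mul_le_weightedSup (hT : ∀ t ∈ T, ∀ y, t y ∈ Set.Icc (-1 : ℝ) 1) (x : Fin n → E)
    (w : Fin n → ℝ) (t : T) : ∑ j, w j * (t : E → ℝ) (x j) ≤ weightedSup T x w := by
  refine le_ciSup (f := fun t : T => ∑ j, w j * (t : E → ℝ) (x j)) ⟨∑ j, |w j|, ?_⟩ t
  rintro _ ⟨s, rfl⟩
  exact (abs_le.1 (abs_sum_mul_le hT x w s)).2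

lemma weightedSup_le_add (hT_ne : T.Nonempty) (hT : ∀ t ∈ T, ∀ y, t y ∈ Set.Icc (-1 : ℝ) 1)
    (x : Fin n → E) (w w' : Fin n → ℝ) :
    weightedSup T x w ≤ weightedSup T x w' + ∑ j, |w j - w' j| := by
  have := hT_ne.to_subtype
  refine ciSup_le fun t => ?_
  have h1 := sum_mul_le_weightedSup hT x w' t
  have h2 := (abs_le.1 (abs_sum_mul_le hT x (fun j => w j - w' j) t)).2
  have h3 : ∑ j, w j * (t : E → ℝ) (x j) = ∑ j, w' j * (t : E → ℝ) (x j)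
      + ∑ j, (w j - w' j) * (t : E → ℝ) (x j) := by
    rw [← Finset.sum_add_distrib]
    exact Finset.sum_congr rfl fun j _ => by ring
  linarith

lemma abs_weightedSup_le (hT_ne : T.Nonempty) (hT : ∀ t ∈ T, ∀ y, t y ∈ Set.Icc (-1 : ℝ) 1)
    (x : Fin n → E) (w : Fin n → ℝ) : |weightedSup T x w| ≤ ∑ j, |w j| := by
  have := hT_ne.to_subtype
  obtain ⟨t, ht⟩ := hT_ne
  refine abs_le.2 ⟨?_, ciSup_le fun t => (abs_le.1 (abs_sum_mul_le hT x w t)).2⟩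
  exact (abs_le.1 (abs_sum_mul_le hT x w ⟨t, ht⟩)).1.trans (sum_mul_le_weightedSup hT x w ⟨t, ht⟩)

lemma continuous_weightedSup (hT_ne : T.Nonempty) (hT : ∀ t ∈ T, ∀ y, t y ∈ Set.Icc (-1 : ℝ) 1)
    (x : Fin n → E) : Continuous (weightedSup T x) := by
  refine (LipschitzWith.of_le_add_mul (n : NNReal) fun w w' => ?_).continuous
  refine (weightedSup_le_add hT_ne hT x w w').trans (add_le_add le_rfl ?_)
  calc ∑ j, |w j - w' j| ≤ ∑ _j : Fin n, dist w w' :=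
        Finset.sum_le_sum fun j _ => dist_le_pi_dist w w' j
    _ = _ := by simp

/-- Sublinearity of the weighted supremum, in the form in which a multiple of the weights is
decomposed into a sum. -/
lemma mul_weightedSup_le_sum (hT_ne : T.Nonempty) (hT : ∀ t ∈ T, ∀ y, t y ∈ Set.Icc (-1 : ℝ) 1)
    (x : Fin n → E) {c : ℝ} (hc : 0 ≤ c) {w : Fin n → ℝ} {v : Fin n → Fin n → ℝ}
    (h : ∀ j, c * w j = ∑ k, v k j) :
    c * weightedSup T x w ≤ ∑ k, weightedSup T x (v k) := by
  have := hT_ne.to_subtype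
  rw [weightedSup, Real.mul_iSup_of_nonneg hc]
  refine ciSup_le fun t => ?_
  have : c * ∑ j, w j * (t : E → ℝ) (x j) = ∑ k, ∑ j, v k j * (t : E → ℝ) (x j) := by
    rw [Finset.sum_comm, Finset.mul_sum]
    refine Finset.sum_congr rfl fun j _ => ?_
    rw [← mul_assoc, h, Finset.sum_mul]
  rw [this]
  exact Finset.sum_le_sum fun k _ => sum_mul_le_weightedSup hT x (v k) t

end WeightedSup

/-! ### Weights with one coordinate left out -/

/-- The weights `w`, averaged over the exchange of the `i`-th one with a uniformly chosen one; see
`mul_leaveOut_eq_sum_swap`. When `w` has sum zero the `i`-th weight becomes zero, so that the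
weighted supremum no longer depends on the `i`-th point. -/
noncomputable def leaveOut {n : ℕ} (w : Fin n → ℝ) (i j : Fin n) : ℝ :=
  if j = i then 0 else (1 - 1 / (n : ℝ)) * w j + w i / n

section LeaveOut

variable {n : ℕ} {w : Fin n → ℝ}

lemma mul_leaveOut_eq_sum_swap (hn : 1 ≤ n) (hw : ∑ k, w k = 0) (i j : Fin n) :
    n * leaveOut w i j = ∑ k, w (Equiv.swap i k j) := by
  have hn0 : (n : ℝ) ≠ 0 := by positivity
  by_cases hj : j = i
  · subst hj
    simp [leaveOut, hw]
  · have : ∀ k, w (Equiv.swap i k j) = w j + if k = j then w i - w j else 0 := by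
      intro k
      by_cases hk : k = j
      · subst hk; simp
      · rw [Equiv.swap_apply_of_ne_of_ne hj (Ne.symm hk)]; simp [hk]
    simp only [this, Finset.sum_add_distrib, Finset.sum_ite_eq', Finset.mem_univ, if_true,
      Finset.sum_const, Finset.card_univ, Fintype.card_fin, nsmul_eq_mul, leaveOut, if_neg hj]
    field_simp
    ring

lemma sum_leaveOut (hn : 1 ≤ n) (hw : ∑ k, w k = 0) (j : Fin n) :
    ((n : ℝ) - 2) * w j = ∑ i, leaveOut w i j := by
  have hn0 : (n : ℝ) ≠ 0 := by positivity
  have h : ∀ i, leaveOut w i j = (1 - 1 / (n : ℝ)) * w j + w i / n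
      - if i = j then w j else 0 := by
    intro i
    by_cases hi : i = j
    · subst hi; simp [leaveOut]; ring
    · simp [leaveOut, hi, Ne.symm hi]
  simp only [h, Finset.sum_sub_distrib, Finset.sum_add_distrib, ← Finset.sum_div, hw,
    Finset.sum_const, Finset.card_univ, Fintype.card_fin, nsmul_eq_mul, Finset.sum_ite_eq',
    Finset.mem_univ, if_true]
  field_simp
  ring

lemma sum_abs_sub_leaveOut_le (i : Fin n) :
    ∑ j, |w j - leaveOut w i j| ≤ |w i| + ∑ j ∈ Finset.univ.erase i, (|w j| + |w i|) / n := by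
  rw [← Finset.add_sum_erase _ _ (Finset.mem_univ i)]
  refine add_le_add (by simp [leaveOut]) (Finset.sum_le_sum fun j hj => ?_)
  have : w j - leaveOut w i j = (w j - w i) / n := by
    rw [leaveOut, if_neg (Finset.ne_of_mem_erase hj)]; ring
  rw [this, abs_div, Nat.abs_cast]
  exact div_le_div_of_nonneg_right (abs_sub _ _) (Nat.cast_nonneg n)

lemma weightedSup_leaveOut {E : Type*} (T : Set (E → ℝ)) (x : Fin n → E) (i : Fin n) :
    weightedSup T x (leaveOut w i) = ⨆ t : T, ∑ j : {j : Fin n // j ≠ i},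
      leaveOut w i j * (t : E → ℝ) (x j) := by
  unfold weightedSup
  congr 1
  ext t
  rw [← Finset.add_sum_erase _ _ (Finset.mem_univ i)]
  simp only [leaveOut, if_true, zero_mul, zero_add]
  exact Finset.sum_subtype _ (by simp) _

end LeaveOut

/-! ### The averaged weighted supremum -/

section Gbar

variable {E : Type*} {n : ℕ} {T : Set (E → ℝ)} {Ω : Type*} [MeasurableSpace Ω] {μ : Measure Ω}
  {ξ : Fin n → Ω → ℝ}

lemma IsExchangeable.identDistrib_apply (hξ : IsExchangeable ξ μ) (i j : Fin n) :
    IdentDistrib (ξ i) (ξ j) μ μ := by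
  have := (hξ (Equiv.swap i j)).comp (measurable_pi_apply j)
  simpa [Function.comp_def] using this

lemma IsExchangeable.integral_weightedSup_perm (hξ : IsExchangeable ξ μ) (hT_ne : T.Nonempty)
    (hT : ∀ t ∈ T, ∀ y, t y ∈ Set.Icc (-1 : ℝ) 1) (x : Fin n → E) (σ : Equiv.Perm (Fin n)) :
    ∫ ω, weightedSup T x (fun i => ξ (σ i) ω) ∂μ = gbar T ξ μ x :=
  ((hξ σ).comp (continuous_weightedSup hT_ne hT x).measurable).integral_eq

lemma integrable_weightedSup (hT_ne : T.Nonempty)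
    (hT : ∀ t ∈ T, ∀ y, t y ∈ Set.Icc (-1 : ℝ) 1) (hξ : ∀ i, Integrable (ξ i) μ)
    (x : Fin n → E) : Integrable (fun ω => weightedSup T x (fun i => ξ i ω)) μ := by
  refine Integrable.mono' (integrable_finsetSum _ fun j _ => (hξ j).abs) ?_
    (Filter.Eventually.of_forall fun ω => abs_weightedSup_le hT_ne hT x fun i => ξ i ω)
  have : AEMeasurable (fun ω i => ξ i ω) μ :=
    aemeasurable_pi_lambda _ fun i => (hξ i).aestronglyMeasurable.aemeasurable
  exact ((continuous_weightedSup hT_ne hT x).measurable.comp_aemeasurable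
    this).aestronglyMeasurable

lemma integrable_leaveOut (hξ : ∀ i, Integrable (ξ i) μ) (i j : Fin n) :
    Integrable (fun ω => leaveOut (fun k => ξ k ω) i j) μ := by
  unfold leaveOut
  split_ifs
  · exact integrable_zero _ _ _
  · exact ((hξ j).const_mul _).add ((hξ i).div_const _)


lemma abs_gbar_le (hT_ne : T.Nonempty) (hT : ∀ t ∈ T, ∀ y, t y ∈ Set.Icc (-1 : ℝ) 1)
    (hξ_int : ∀ i, Integrable (ξ i) μ) {κ : ℝ} (hκ : ∀ i, ∫ ω, |ξ i ω| ∂μ = κ)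
    (x : Fin n → E) : |gbar T ξ μ x| ≤ n * κ := by
  refine abs_integral_le_integral_abs.trans ?_
  calc ∫ ω, |weightedSup T x (fun i => ξ i ω)| ∂μ ≤ ∫ ω, ∑ j, |ξ j ω| ∂μ :=
        integral_mono (integrable_weightedSup hT_ne hT hξ_int x).abs
          (integrable_finsetSum _ fun j _ => (hξ_int j).abs)
          fun ω => abs_weightedSup_le hT_ne hT x fun i => ξ i ω
    _ = n * κ := by
        rw [integral_finsetSum _ fun j _ => (hξ_int j).abs]
        simp [hκ]

/-- Leaving out the `i`-th point decreases the average: by exchangeability and convexity, since the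
weights `leaveOut` are an average of permutations of the original ones. -/
lemma integral_leaveOut_le_gbar (hT_ne : T.Nonempty)
    (hT : ∀ t ∈ T, ∀ y, t y ∈ Set.Icc (-1 : ℝ) 1) (hn : 1 ≤ n) (hξ_exch : IsExchangeable ξ μ)
    (hξ_int : ∀ i, Integrable (ξ i) μ) (hξ_sum : ∀ᵐ ω ∂μ, ∑ i, ξ i ω = 0) (x : Fin n → E)
    (i : Fin n) :
    ∫ ω, weightedSup T x (leaveOut (fun k => ξ k ω) i) ∂μ ≤ gbar T ξ μ x := by
  have hn0 : (0 : ℝ) < n := by positivity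
  have hperm : ∀ k, Integrable (fun ω => weightedSup T x (fun j => ξ (Equiv.swap i k j) ω)) μ :=
    fun k => integrable_weightedSup (ξ := fun j => ξ (Equiv.swap i k j)) hT_ne hT
      (fun j => hξ_int _) x
  have h := integral_mono_ae
    ((integrable_weightedSup (ξ := fun j ω => leaveOut (fun k => ξ k ω) i j) hT_ne hT
      (fun j => integrable_leaveOut hξ_int i j) x).const_mul (n : ℝ))
    (integrable_finsetSum Finset.univ fun k _ => hperm k)
    (hξ_sum.mono fun ω hω => mul_weightedSup_le_sum hT_ne hT x hn0.le
      (v := fun k j => ξ (Equiv.swap i k j) ω) (mul_leaveOut_eq_sum_swap hn hω i))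
  rw [integral_const_mul, integral_finsetSum _ fun k _ => hperm k] at h
  simp only [hξ_exch.integral_weightedSup_perm hT_ne hT, Finset.sum_const, Finset.card_univ,
    Fintype.card_fin, nsmul_eq_mul] at h
  exact le_of_mul_le_mul_left h hn0

lemma gbar_sub_integral_leaveOut_le (hT_ne : T.Nonempty)
    (hT : ∀ t ∈ T, ∀ y, t y ∈ Set.Icc (-1 : ℝ) 1) (hn : 1 ≤ n)
    (hξ_int : ∀ i, Integrable (ξ i) μ) {κ : ℝ} (hκ : ∀ i, ∫ ω, |ξ i ω| ∂μ = κ) (x : Fin n → E)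
    (i : Fin n) :
    gbar T ξ μ x - ∫ ω, weightedSup T x (leaveOut (fun k => ξ k ω) i) ∂μ
      ≤ κ * (3 - 2 / (n : ℝ)) := by
  have hn0 : (n : ℝ) ≠ 0 := by positivity
  have hw := integrable_weightedSup hT_ne hT hξ_int x
  have hl := integrable_weightedSup (ξ := fun j ω => leaveOut (fun k => ξ k ω) i j) hT_ne hT
    (fun j => integrable_leaveOut hξ_int i j) x
  have hs : ∀ j, Integrable (fun ω => (|ξ j ω| + |ξ i ω|) / (n : ℝ)) μ :=
    fun j => ((hξ_int j).abs.add (hξ_int i).abs).div_const _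
  have hsum := integrable_finsetSum (Finset.univ.erase i) fun j _ => hs j
  rw [gbar, ← integral_sub hw hl]
  calc _ ≤ ∫ ω, (|ξ i ω| + ∑ j ∈ Finset.univ.erase i, (|ξ j ω| + |ξ i ω|) / (n : ℝ)) ∂μ := by
        refine integral_mono (hw.sub hl) ((hξ_int i).abs.add hsum) fun ω => ?_
        have h1 := weightedSup_le_add hT_ne hT x (fun k => ξ k ω) (leaveOut (fun k => ξ k ω) i)
        have h2 := sum_abs_sub_leaveOut_le (w := fun k => ξ k ω) i
        linarith
    _ = κ * (3 - 2 / (n : ℝ)) := by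
        rw [integral_add (hξ_int i).abs hsum, integral_finsetSum _ fun j _ => hs j]
        simp only [integral_div, integral_add (hξ_int _).abs (hξ_int i).abs, hκ,
          Finset.sum_const, Finset.card_erase_of_mem (Finset.mem_univ i), Finset.card_univ,
          Fintype.card_fin, nsmul_eq_mul, Nat.cast_sub hn, Nat.cast_one]
        field_simp
        ring

/-- This gives the constant `2` of the self-bounding property: the weights `leaveOut w i` add up
to `n - 2` times `w`. -/
lemma mul_gbar_le_sum_integral_leaveOut (hT_ne : T.Nonempty)
    (hT : ∀ t ∈ T, ∀ y, t y ∈ Set.Icc (-1 : ℝ) 1) (hn : 2 ≤ n)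
    (hξ_int : ∀ i, Integrable (ξ i) μ) (hξ_sum : ∀ᵐ ω ∂μ, ∑ i, ξ i ω = 0) (x : Fin n → E) :
    ((n : ℝ) - 2) * gbar T ξ μ x ≤
      ∑ i, ∫ ω, weightedSup T x (leaveOut (fun k => ξ k ω) i) ∂μ := by
  have hl := fun i => integrable_weightedSup (ξ := fun j ω => leaveOut (fun k => ξ k ω) i j)
    hT_ne hT (fun j => integrable_leaveOut hξ_int i j) x
  have hn2 : (2 : ℝ) ≤ n := by exact_mod_cast hn
  rw [gbar, ← integral_const_mul, ← integral_finsetSum _ fun i _ => hl i]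
  refine integral_mono_ae ((integrable_weightedSup hT_ne hT hξ_int x).const_mul _)
    (integrable_finsetSum _ fun i _ => hl i) (hξ_sum.mono fun ω hω => ?_)
  exact mul_weightedSup_le_sum hT_ne hT x (by linarith) (sum_leaveOut (by omega) hω)

/-- Exchangeable weights of sum zero average to a self-bounding function of the points. -/
theorem isSelfBounding_gbar (hT_ne : T.Nonempty)
    (hT : ∀ t ∈ T, ∀ y, t y ∈ Set.Icc (-1 : ℝ) 1) (hn : 1 ≤ n) (hξ_exch : IsExchangeable ξ μ)
    (hξ_int : ∀ i, Integrable (ξ i) μ) (hξ_sum : ∀ᵐ ω ∂μ, ∑ i, ξ i ω = 0)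
    {κ : ℝ} (hκ : ∀ i, ∫ ω, |ξ i ω| ∂μ = κ) (hκ0 : 0 < κ) :
    IsSelfBounding 2 0 (fun x : Fin n → E => gbar T ξ μ x / (κ * (3 - 2 / (n : ℝ)))) := by
  have hn2 : 2 ≤ n := by
    by_contra! hlt
    obtain rfl : n = 1 := by omega
    have h0 : ∫ ω, |ξ 0 ω| ∂μ = 0 := by
      rw [integral_congr_ae (g := 0) (hξ_sum.mono fun ω hω => ?_)]
      · simp
      · simpa using hω
    exact hκ0.ne' ((hκ 0).symm.trans h0)
  have hn2' : (2 : ℝ) ≤ n := by exact_mod_cast hn2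
  have hfac : (0 : ℝ) < 3 - 2 / n := by
    have : 2 / (n : ℝ) ≤ 1 := (div_le_one (by linarith)).2 hn2'
    linarith
  have hK : 0 < κ * (3 - 2 / (n : ℝ)) := mul_pos hκ0 hfac
  refine ⟨fun i z => (∫ ω, ⨆ t : T, ∑ j : {j : Fin n // j ≠ i},
    leaveOut (fun k => ξ k ω) i j * (t : E → ℝ) (z j) ∂μ) / (κ * (3 - 2 / (n : ℝ))),
    fun x => ?_⟩
  simp only [← weightedSup_leaveOut T x, ← sub_div]
  refine ⟨fun i => ⟨div_nonneg (sub_nonneg.2 ?_) hK.le, (div_le_one hK).2 ?_⟩, ?_⟩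
  · exact integral_leaveOut_le_gbar hT_ne hT hn hξ_exch hξ_int hξ_sum x i
  · exact gbar_sub_integral_leaveOut_le hT_ne hT hn hξ_int hκ x i
  · rw [← Finset.sum_div, add_zero, ← mul_div_assoc]
    refine div_le_div_of_nonneg_right ?_ hK.le
    have := mul_gbar_le_sum_integral_leaveOut hT_ne hT hn2 hξ_int hξ_sum x
    rw [Finset.sum_sub_distrib]
    simp only [Finset.sum_const, Finset.card_univ, Fintype.card_fin, nsmul_eq_mul]
    linarith

end Gbar

/-! ### Concentration of the averaged weighted supremum -/

lemma mul_sqrt_div_le {K κ m x : ℝ} (hK : 0 < K) (hKκ : K ≤ 3 * κ) (hm : 0 ≤ m) (hx : 0 < x) :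
    K * √(2 * (2 * (m / K) + 0) * x) ≤ √(12 * κ * x * m) := by
  have h : K * √(2 * (2 * (m / K) + 0) * x) = √(K ^ 2 * (2 * (2 * (m / K) + 0) * x)) := by
    rw [Real.sqrt_mul (sq_nonneg K), Real.sqrt_sq hK.le]
  rw [h]
  refine Real.sqrt_le_sqrt ?_
  have : K ^ 2 * (2 * (2 * (m / K) + 0) * x) = K * (4 * x * m) := by field_simp; ring
  rw [this]
  have := mul_le_mul_of_nonneg_right hKκ (show 0 ≤ 4 * x * m by positivity)
  linarith

theorem mainTheorem1 {E : Type*} [MeasurableSpace E] (n : ℕ) (hn : 1 ≤ n)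
    (T : Set (E → ℝ)) (hT_ne : T.Nonempty) (hT : ∀ t ∈ T, ∀ y, t y ∈ Set.Icc (-1 : ℝ) 1)
    {Ω' : Type*} [MeasurableSpace Ω'] (μ : Measure Ω') [IsProbabilityMeasure μ]
    (ξ : Fin n → Ω' → ℝ) (hξ_exch : IsExchangeable ξ μ)
    (hξ_int : Integrable (ξ ⟨0, hn⟩) μ) (hξ_sum : ∀ᵐ ω ∂μ, ∑ i, ξ i ω = 0)
    (κ : ℝ) (hκ : κ = ∫ ω, |ξ ⟨0, hn⟩ ω| ∂μ) :
    -- the expectation defining `gbar` is well defined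
    (∀ x : Fin n → E, Integrable (fun ω => weightedSup T x (fun i => ξ i ω)) μ) ∧
    (0 < κ → IsSelfBounding 2 0 (fun x : Fin n → E => gbar T ξ μ x / (κ * (3 - 2 / (n : ℝ))))) ∧
    ∀ {Ω : Type*} [MeasurableSpace Ω] (P : Measure Ω) [IsProbabilityMeasure P]
      (X : Fin n → Ω → E), (∀ i, Measurable (X i)) → iIndepFun X P →
      AEMeasurable (gbar T ξ μ) (P.map (fun ω i => X i ω)) →
      Integrable (fun ω => gbar T ξ μ (fun i => X i ω)) P ∧
      ∀ x : ℝ, 0 < x →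
        1 - Real.exp (-x) ≤ P.real {ω | gbar T ξ μ (fun i => X i ω) ≤
          (∫ ω', gbar T ξ μ (fun i => X i ω') ∂P) +
            √(12 * κ * x * ∫ ω', gbar T ξ μ (fun i => X i ω') ∂P) + 5 * κ * x} ∧
        1 - Real.exp (-x) ≤ P.real {ω | (∫ ω', gbar T ξ μ (fun i => X i ω') ∂P) -
            √(12 * κ * x * ∫ ω', gbar T ξ μ (fun i => X i ω') ∂P) ≤
          gbar T ξ μ (fun i => X i ω)} := by
  have hident := fun i => hξ_exch.identDistrib_apply ⟨0, hn⟩ i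
  have hint : ∀ i, Integrable (ξ i) μ := fun i => (hident i).integrable_iff.1 hξ_int
  have hκi : ∀ i, ∫ ω, |ξ i ω| ∂μ = κ := fun i => by
    rw [hκ]
    exact (((hident i).comp measurable_norm).integral_eq).symm
  have hsb := isSelfBounding_gbar hT_ne hT hn hξ_exch hint hξ_sum hκi
  refine ⟨integrable_weightedSup hT_ne hT hint, hsb, ?_⟩
  intro Ω _ P _ X hX hindep hmeas
  have hXm : Measurable fun ω i => X i ω := measurable_pi_lambda _ hX
  have hbd := abs_gbar_le hT_ne hT hint hκi
  refine ⟨Integrable.of_bound (hmeas.comp_measurable hXm).aestronglyMeasurable (n * κ)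
    (Filter.Eventually.of_forall fun ω => hbd _), fun x hx => ?_⟩
  have hκ0 : 0 ≤ κ := hκ ▸ integral_nonneg fun ω => abs_nonneg _
  rcases hκ0.eq_or_lt with rfl | hκpos
  · have hzero : ∀ y, gbar T ξ μ y = 0 := fun y => by simpa using hbd y
    simp [hzero, (Real.exp_pos _).le]
  specialize hsb hκpos
  have hn1 : (1 : ℝ) ≤ n := by exact_mod_cast hn
  have hfac : (0 : ℝ) < 3 - 2 / n := by
    have : 2 / (n : ℝ) ≤ 2 := div_le_self (by norm_num) hn1
    linarith
  set K := κ * (3 - 2 / (n : ℝ)) with hKdef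
  have hK : 0 < K := mul_pos hκpos hfac
  have hK3 : K ≤ 3 * κ := by
    have : 0 ≤ κ * (2 / (n : ℝ)) := by positivity
    rw [hKdef]; linarith
  have hprob : ∀ i, IsProbabilityMeasure (P.map (X i)) :=
    fun i => Measure.isProbabilityMeasure_map (hX i).aemeasurable
  have hlaw := (iIndepFun_iff_map_fun_eq_pi_map fun i => (hX i).aemeasurable).1 hindep
  have hmean : ∫ y, gbar T ξ μ y / K ∂Measure.pi (fun i => P.map (X i))
      = (∫ ω, gbar T ξ μ (fun i => X i ω) ∂P) / K := by
    rw [← hlaw, integral_div, integral_map hXm.aemeasurable hmeas.aestronglyMeasurable]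
  have hmeas' := hmeas
  rw [hlaw] at hmeas'
  have hbd' : ∀ y, |gbar T ξ μ y / K| ≤ n * κ / K := fun y => by
    rw [abs_div, abs_of_pos hK]
    exact div_le_div_of_nonneg_right (hbd y) hK.le
  have hup := hsb.upper_tail (fun i => P.map (X i)) two_pos (hmeas'.div_const K) hbd' hx
  have hlo := hsb.lower_tail (fun i => P.map (X i)) one_le_two (hmeas'.div_const K) hbd' hx
  have hm0 := hsb.integral_nonneg (fun i => P.map (X i))
    (Integrable.of_bound (hmeas'.div_const K).aestronglyMeasurable _
      (Filter.Eventually.of_forall hbd'))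
  rw [hmean] at hup hlo hm0
  set m := ∫ ω, gbar T ξ μ (fun i => X i ω) ∂P
  have hm : 0 ≤ m := by
    have h : 0 ≤ m / K := by linarith
    simpa [hK.ne'] using mul_nonneg h hK.le
  have hsqrt := mul_sqrt_div_le hK hK3 hm hx
  rw [← hlaw] at hup hlo
  rw [measureReal_def, Measure.map_apply₀ hXm.aemeasurable
    (nullMeasurableSet_le (hmeas.div_const K) aemeasurable_const), ← measureReal_def] at hup
  rw [measureReal_def, Measure.map_apply₀ hXm.aemeasurable
    (nullMeasurableSet_le aemeasurable_const (hmeas.div_const K)), ← measureReal_def] at hlo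
  refine ⟨hup.trans (measureReal_mono fun ω hω => ?_), hlo.trans (measureReal_mono fun ω hω => ?_)⟩
  · have h : gbar T ξ μ (fun i => X i ω) / K
        ≤ m / K + √(2 * (2 * (m / K) + 0) * x) + 2 / 2 * x := hω
    rw [div_le_iff₀ hK] at h
    have h1 : (m / K + √(2 * (2 * (m / K) + 0) * x) + 2 / 2 * x) * K
        = m + K * √(2 * (2 * (m / K) + 0) * x) + K * x := by field_simp
    have h2 := mul_le_mul_of_nonneg_right hK3 hx.le
    have h3 : 0 < κ * x := mul_pos hκpos hx
    change gbar T ξ μ (fun i => X i ω) ≤ _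
    linarith
  · have h : m / K - √(2 * (2 * (m / K) + 0) * x) ≤ gbar T ξ μ (fun i => X i ω) / K := hω
    rw [le_div_iff₀ hK] at h
    have h1 : (m / K - √(2 * (2 * (m / K) + 0) * x)) * K
        = m - K * √(2 * (2 * (m / K) + 0) * x) := by field_simp
    change _ ≤ gbar T ξ μ (fun i => X i ω)
    linarith
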